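/- Let $X$ be a separable reflexive real Banach space with Borel $\sigma$-algebra $\mathcal X$, let $P$ be a probability measure on $(X,\mathcal X)$, let $(\xi_i)_{i\ge 1}$ be independent $X$-valued random elements on a probability space $(\Omega,\mathcal F,\mathbb P)$ with common law $P$, let $k\ge 1$, and let $d:X\times X\to[0,\infty)$. (Reflexive means that the canonical embedding of $X$ into its bidual is onto; $\rightharpoonup$ denotes weak convergence.) Assume: 1. There are continuous, strictly increasing functions $m,M:[0,\infty)\to[0,\infty)$ with $m(\|x-y\|)\le d(x,y)\le M(\|x-y\|)$ for all $x,y\in X$, $\lim_{r\to\infty}m(r)=\infty$, $M(0)=0$, some $\gamma<\infty$ such that $M(\|x+y\|)\le\gamma M(\|x\|)+\gamma M(\|y\|)$ for all $x,y\in X$, and $\int_X M(\|x\|)\,P(dx)<\infty$. 2. Whenever $x_a\to x$ strongly and $y_b\rightharpoonup y$ weakly, $\liminf_{a,b\to\infty}d(x_a,y_b)\ge d(x,y)$ and $\lim_{a\to\infty}d(x_a,y)=d(x,y)$. 3. For each $y\in X$, $d(\cdot,y)$ is $\mathcal X$-measurable. 4. There are $k$ distinct points $\mu^\dagger_1,\dots,\mu^\dagger_k\in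 X$ such that every open ball $B(\mu^\dagger_j,\delta)$, $\delta>0$, has positive $P$-probability. For $\mu=(\mu_1,\dots,\mu_k)\in X^k$ (with norm $\max_j\|\mu_j\|$) set $$f_n^{(\omega)}(\mu)=\frac1n\sum_{i=1}^n\min_{1\le j\le k}d(\xi_i^{(\omega)},\mu_j)\quad(n\ge1),\qquad f_\infty(\mu)=\int_X\min_{1\le j\le k}d(x,\mu_j)\,P(dx).$$ Then $f_\infty$ is finite on $X^k$ and attains its minimum, and for $\mathbb P$-almost every $\omega$ the following hold. Each $f_n^{(\omega)}$, $n\ge1$, attains its minimum, and $$\lim_{n\to\infty}\min_{\mu\in X^k}f_n^{(\omega)}(\mu)=\min_{\mu\in X^k}f_\infty(\mu).$$ Furthermore, for every sequence $(\mu^n)$ in $X^k$ such that $\mu^n$ minimizes $f_n^{(\omega)}$ for every $n\ge1$: the set of its terms is weakly precompact (its closure in the weak topology of $X^k$ is weakly compact), every subsequence has a weakly convergent further subsequence, and every weak limit point (cluster point in the weak topology) of $(\mu^n)$ minimizes $f_\infty$. -/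

import Mathlib

open Filter Topology MeasureTheory ProbabilityTheory
open scoped NNReal ENNReal

noncomputable section

/-- A real normed space is reflexive if the canonical embedding into its bidual is onto
(the embedding is always a linear isometry). -/
def IsReflexiveSpace (E : Type*) [NormedAddCommGroup E] [NormedSpace ℝ E] : Prop :=
  Function.Surjective (NormedSpace.inclusionInDoubleDual ℝ E)

/-- Weak convergence of a sequence: `F (u n) → F x` for every bounded linear functional `F`. -/
def WeakTendsto {E : Type*} [NormedAddCommGroup E] [NormedSpace ℝ E] (u : ℕ → E) (x : E) : Prop :=
  ∀ F : StrongDual ℝ E, Tendsto (fun n => F (u n)) atTop (𝓝 (F x))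

/-- A set is weakly precompact if its closure in the weak topology is weakly compact. -/
def IsWeaklyPrecompact {E : Type*} [NormedAddCommGroup E] [NormedSpace ℝ E] (S : Set E) : Prop :=
  IsCompact (closure (toWeakSpace ℝ E '' S))

/-- `x` is a weak limit point of the sequence `u`: every weak neighbourhood of `x` contains
`u n` for infinitely many indices `n`. -/
def IsWeakLimitPoint {E : Type*} [NormedAddCommGroup E] [NormedSpace ℝ E]
    (u : ℕ → E) (x : E) : Prop :=
  MapClusterPt (toWeakSpace ℝ E x) atTop (fun n => toWeakSpace ℝ E (u n))

/-- `g_μ(x) = min_{1 ≤ j ≤ k} d(x, μ_j)` (used for `k ≥ 1` only). -/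
def minCost {X : Type*} {k : ℕ} (d : X → X → ℝ≥0) (μ : Fin k → X) (x : X) : ℝ≥0 :=
  ⨅ j, d x (μ j)

/-- The empirical energy `f_n(μ) = (1/n) ∑_{i=1}^n g_μ(ξ_i)` of a data sequence; the observations
`ξ_1, ξ_2, …` are indexed here as `x 0, x 1, …`. -/
def empiricalEnergy {X : Type*} {k : ℕ} (d : X → X → ℝ≥0) (x : ℕ → X) (n : ℕ)
    (μ : Fin k → X) : ℝ :=
  (1 / (n : ℝ)) * ∑ i ∈ Finset.range n, (minCost d μ (x i) : ℝ)

/-- The limiting energy `f_∞(μ) = ∫ g_μ dP`. -/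
def limitEnergy {X : Type*} [MeasurableSpace X] {k : ℕ} (d : X → X → ℝ≥0) (P : Measure X)
    (μ : Fin k → X) : ℝ :=
  ∫ x, (minCost d μ x : ℝ) ∂P

/-- The assumptions on the cost function `d : X × X → [0,∞)` and the law `P`. -/
structure CostAssumptions {X : Type*} [NormedAddCommGroup X] [NormedSpace ℝ X]
    [MeasurableSpace X] (k : ℕ) (d : X → X → ℝ≥0) (P : Measure X) : Prop where
  /-- Norm-type bounds with a moment condition. -/
  bounds : ∃ m M : ℝ≥0 → ℝ≥0, Continuous m ∧ StrictMono m ∧ Continuous M ∧ StrictMono M ∧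
    (∀ x y : X, m ‖x - y‖₊ ≤ d x y ∧ d x y ≤ M ‖x - y‖₊) ∧
    Tendsto m atTop atTop ∧ M 0 = 0 ∧
    (∃ γ : ℝ≥0, ∀ x y : X, M ‖x + y‖₊ ≤ γ * M ‖x‖₊ + γ * M ‖y‖₊) ∧
    ∫⁻ x, (M ‖x‖₊ : ℝ≥0∞) ∂P < ∞
  /-- Joint lower semicontinuity (the lower limit is taken in `[0,∞]`, over `a, b → ∞`
  independently). -/
  lsc : ∀ (x y : X) (u v : ℕ → X), Tendsto u atTop (𝓝 x) → WeakTendsto v y →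
    (d x y : ℝ≥0∞) ≤
      liminf (fun p : ℕ × ℕ => (d (u p.1) (v p.2) : ℝ≥0∞)) (atTop ×ˢ atTop)
  /-- Strong continuity in the first variable. -/
  cont : ∀ (x y : X) (u : ℕ → X), Tendsto u atTop (𝓝 x) →
    Tendsto (fun a => d (u a) y) atTop (𝓝 (d x y))
  /-- Measurability in the first variable. -/
  meas : ∀ y : X, Measurable fun x => d x y
  /-- There are `k` distinct points all of whose neighbourhoods have positive probability. -/
  fit : ∃ c : Fin k → X, Function.Injective c ∧
    ∀ δ : ℝ, 0 < δ → ∀ j, 0 < P (Metric.ball (c j) δ)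

end

/-!
The energies are studied on an enlarged set of centres: a centre may also lie at infinity, where its
cost is `∞` (`extCost`, `extEnergy`). Since a separable reflexive space has weakly sequentially
compact closed balls, every sequence of `k`-tuples has a subsequence each of whose coordinates
converges weakly or tends to infinity in norm
(`IsReflexiveSpace.exists_extTendsto_subseq_pi`).

Along such sequences the energies satisfy a `Γ`-liminf inequality
(`CostAssumptions.extEnergy_le_liminf`). Pointwise it is the joint lower semicontinuity of the cost,
or the growth of `m` for centres tending to infinity; it is integrated by a Fatou lemma for varying
measures (`lintegral_le_liminf_lintegral_of_joint_liminf`), whose integrands are approximated from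
below by bounded Lipschitz functions, to which the portmanteau theorem applies. The empirical
measures satisfy the open-set condition of that theorem almost surely, by the law of large numbers
for the countably many finite unions of basic open sets
(`ae_forall_isOpen_le_liminf_empiricalMeasure`).

With a constant sequence of measures, the inequality gives the existence of minimizers by the direct
method (`CostAssumptions.exists_extEnergy_min`). The matching upper bound for the minima needs the
law of large numbers only at one fixed minimizer of the limit energy. Hence limits of minimizers of
the empirical energies have minimal limit energy. None of their centres is at infinity: otherwise,
of the `k` points all of whose neighbourhoods have positive probability, one would not be a centre,
and moving the centre at infinity there would lower the energy strictly
(`CostAssumptions.exists_extEnergy_lt`). So minimizers remain bounded, and weak compactness of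
bounded sets gives the remaining claims.
-/

/-! ### Weak sequential compactness in separable reflexive spaces -/

section Weak

variable {E : Type*} [NormedAddCommGroup E] [NormedSpace ℝ E]

theorem weakTendsto_iff {u : ℕ → E} {x : E} :
    WeakTendsto u x ↔ Tendsto (fun n => toWeakSpace ℝ E (u n)) atTop (𝓝 (toWeakSpace ℝ E x)) :=
  (WeakBilin.tendsto_iff_forall_eval_tendsto (topDualPairing ℝ E).flip
    (fun _ _ h => SeparatingDual.eq_iff_forall_dual_eq (R := ℝ) |>.2 fun g =>
      DFunLike.congr_fun h g)).symm

theorem WeakTendsto.unique {u : ℕ → E} {x y : E} (hx : WeakTendsto u x) (hy : WeakTendsto u y) :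
    x = y :=
  SeparatingDual.eq_iff_forall_dual_eq (R := ℝ) |>.2 fun F => tendsto_nhds_unique (hx F) (hy F)

theorem weakTendsto_pi {k : ℕ} {u : ℕ → Fin k → E} {x : Fin k → E} :
    WeakTendsto u x ↔ ∀ j, WeakTendsto (fun n => u n j) (x j) := by
  refine ⟨fun h j F => h (F.comp (ContinuousLinearMap.proj j)), fun h F => ?_⟩
  have key : ∀ y : Fin k → E,
      F y = ∑ j, F.comp (ContinuousLinearMap.single ℝ (fun _ : Fin k => E) j) (y j) := by
    intro y
    conv_lhs => rw [← Finset.univ_sum_single y]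
    simp
  simp_rw [key]
  exact tendsto_finsetSum _ fun j _ => h j _

/-- By the uniform boundedness principle in the bidual, the norms along a weakly convergent
sequence do not tend to infinity. -/
theorem WeakTendsto.not_tendsto_norm_atTop {u : ℕ → E} {x : E} (h : WeakTendsto u x) :
    ¬ Tendsto (fun n => ‖u n‖) atTop atTop := by
  intro hu
  obtain ⟨C, hC⟩ := banach_steinhaus (g := fun n => NormedSpace.inclusionInDoubleDual ℝ E (u n))
    fun F => by
      obtain ⟨C, hC⟩ := (h F).norm.bddAbove_range
      exact ⟨C, fun n => hC ⟨n, rfl⟩⟩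
  obtain ⟨n, hn⟩ := (hu.eventually_gt_atTop C).exists
  refine (hn.trans_le ?_).not_ge (hC n)
  exact ((NormedSpace.inclusionInDoubleDualLi ℝ (E := E)).norm_map (u n)).ge

theorem IsReflexiveSpace.pi (hE : IsReflexiveSpace E) (k : ℕ) :
    IsReflexiveSpace (Fin k → E) := by
  intro Φ
  -- the `j`-th coordinate of the representing point represents the restriction of `Φ` to the
  -- functionals that depend on the `j`-th coordinate only
  have hcoord : ∀ j : Fin k, ∃ x : E, ∀ F : StrongDual ℝ E,
      F x = Φ (F.comp (ContinuousLinearMap.proj j)) := by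
    intro j
    let T : StrongDual ℝ E →L[ℝ] StrongDual ℝ (Fin k → E) :=
      (ContinuousLinearMap.compL ℝ (Fin k → E) E ℝ).flip (ContinuousLinearMap.proj j)
    obtain ⟨x, hx⟩ := hE (Φ.comp T)
    exact ⟨x, fun F => by simpa [T] using! DFunLike.congr_fun hx F⟩
  choose x hx using hcoord
  refine ⟨x, ?_⟩
  ext F
  have hF : F = ∑ j, (F.comp (ContinuousLinearMap.single ℝ (fun _ : Fin k => E) j)).comp
      (ContinuousLinearMap.proj j) := by
    ext y
    conv_lhs => rw [← Finset.univ_sum_single y]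
    simp
  rw [NormedSpace.dual_def]
  conv_rhs => rw [hF, map_sum]
  conv_lhs => rw [hF]
  simp only [← hx]
  simp

theorem IsReflexiveSpace.isWeaklyPrecompact (hE : IsReflexiveSpace E) {S : Set E}
    (hS : Bornology.IsBounded S) : IsWeaklyPrecompact S := by
  refine NormedSpace.isCompact_closure_of_isBounded ℝ E _ ?_ ?_
  · rwa [Set.preimage_image_eq _ (toWeakSpace ℝ E).injective]
  · intro Φ _
    obtain ⟨x, hx⟩ := hE (WeakDual.toStrongDual Φ)
    exact ⟨toWeakSpace ℝ E x, hx⟩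

/-- The functionals are norming functionals of the points of a dense sequence. -/
theorem exists_separating_seq_strongDual (E : Type*) [NormedAddCommGroup E] [NormedSpace ℝ E]
    [TopologicalSpace.SeparableSpace E] :
    ∃ F : ℕ → StrongDual ℝ E, ∀ x, (∀ n, F n x = 0) → x = 0 := by
  choose F hF hFx using fun n =>
    exists_dual_vector'' ℝ (TopologicalSpace.denseSeq E n)
  refine ⟨F, fun x hx => ?_⟩
  rw [← norm_le_zero_iff]
  refine le_of_forall_pos_le_add fun ε hε => ?_
  obtain ⟨n, hn⟩ := (TopologicalSpace.denseRange_denseSeq E).exists_dist_lt x (half_pos hε)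
  set y := TopologicalSpace.denseSeq E n
  rw [dist_eq_norm] at hn
  have h1 : ‖y‖ ≤ ‖x - y‖ := by
    have h2 : F n (x - y) = -‖y‖ := by simp [map_sub, hx n, hFx n, y]
    have h3 := (F n).le_of_opNorm_le (hF n) (x - y)
    simpa [h2] using! h3
  have h2 : ‖x‖ ≤ ‖x - y‖ + ‖y‖ := by simpa using norm_add_le (x - y) y
  linarith

/-- Weak closures of bounded sets are metrizable in a separable reflexive space, so that weak
limit points of bounded sequences are limits of subsequences. -/
theorem IsReflexiveSpace.exists_weakTendsto_of_isWeakLimitPoint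
    [TopologicalSpace.SeparableSpace E] (hE : IsReflexiveSpace E) {u : ℕ → E}
    (hu : Bornology.IsBounded (Set.range u)) {x : E} (hx : IsWeakLimitPoint u x) :
    ∃ φ : ℕ → ℕ, StrictMono φ ∧ WeakTendsto (fun n => u (φ n)) x := by
  set K := closure (toWeakSpace ℝ E '' Set.range u) with hK
  have hKc : IsCompact K := hE.isWeaklyPrecompact hu
  have : CompactSpace K := isCompact_iff_compactSpace.mp hKc
  obtain ⟨F, hF⟩ := exists_separating_seq_strongDual E
  have hFc : ∀ n, Continuous fun z : WeakSpace ℝ E => F n ((toWeakSpace ℝ E).symm z) := fun n =>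
    WeakBilin.eval_continuous (topDualPairing ℝ E).flip (F n)
  have : TopologicalSpace.MetrizableSpace K :=
    Metric.PiNatEmbed.TopologicalSpace.MetrizableSpace.of_countable_separating
      (fun n (z : K) => F n ((toWeakSpace ℝ E).symm z))
      (fun n => (hFc n).comp continuous_subtype_val) fun z w hzw => by
        by_contra! h
        refine hzw (Subtype.ext ((toWeakSpace ℝ E).symm.injective ?_))
        rw [← sub_eq_zero]
        exact hF _ fun n => by rw [map_sub, h n, sub_self]
  have huK : ∀ n, toWeakSpace ℝ E (u n) ∈ K := fun n => subset_closure ⟨u n, ⟨n, rfl⟩, rfl⟩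
  have hxK : toWeakSpace ℝ E x ∈ K :=
    isClosed_closure.closure_subset (mem_closure_iff_clusterPt.2
      (ClusterPt.mono hx (le_principal_iff.2 (mem_map.2 (Eventually.of_forall huK)))))
  have hcl : MapClusterPt (⟨_, hxK⟩ : K) atTop (fun n => (⟨_, huK n⟩ : K)) := by
    rw [IsWeakLimitPoint, mapClusterPt_iff_frequently] at hx
    rw [mapClusterPt_iff_frequently]
    intro s hs
    obtain ⟨t, ht, hts⟩ := mem_nhds_subtype _ _ _ |>.1 hs
    exact (hx t ht).mono fun n hn => hts hn
  obtain ⟨φ, hφ, hlim⟩ := hcl.tendsto_subseq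
  exact ⟨φ, hφ, weakTendsto_iff.2 ((continuous_subtype_val.tendsto _).comp hlim)⟩

theorem IsReflexiveSpace.exists_weakTendsto_subseq
    [TopologicalSpace.SeparableSpace E] (hE : IsReflexiveSpace E) {u : ℕ → E}
    (hu : Bornology.IsBounded (Set.range u)) :
    ∃ (φ : ℕ → ℕ) (x : E), StrictMono φ ∧ WeakTendsto (fun n => u (φ n)) x := by
  obtain ⟨x, -, hx⟩ := (hE.isWeaklyPrecompact hu).exists_mapClusterPt
    (f := atTop) (u := fun n => toWeakSpace ℝ E (u n))
    (le_principal_iff.2 (mem_map.2 (Eventually.of_forall fun n =>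
      subset_closure ⟨u n, ⟨n, rfl⟩, rfl⟩)))
  obtain ⟨φ, hφ, h⟩ := hE.exists_weakTendsto_of_isWeakLimitPoint hu
    (x := (toWeakSpace ℝ E).symm x) (by simpa [IsWeakLimitPoint] using hx)
  exact ⟨φ, _, hφ, h⟩

end Weak

/-! ### Fatou's lemma along varying measures -/

section Fatou

variable {X : Type*} [PseudoEMetricSpace X]

/-- The `N`-Lipschitz envelope of the tail infimum of the truncations `min (g n) N`, `n ≥ N`. -/
noncomputable def tailLipschitzEnvelope (g : ℕ → X → ℝ≥0∞) (N : ℕ) (x : X) : ℝ≥0∞ :=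
  ⨅ (n) (_ : N ≤ n) (y), min (g n y) N + N * edist x y

theorem tailLipschitzEnvelope_le {g : ℕ → X → ℝ≥0∞} {N n : ℕ} (h : N ≤ n) (x : X) :
    tailLipschitzEnvelope g N x ≤ min (g n x) N :=
  (iInf₂_le n h).trans ((iInf_le _ x).trans (by simp))

theorem continuous_tailLipschitzEnvelope (g : ℕ → X → ℝ≥0∞) (N : ℕ) :
    Continuous (tailLipschitzEnvelope g N) := by
  refine continuous_of_le_add_edist N (by simp) fun x x' => ?_
  simp only [tailLipschitzEnvelope, ENNReal.iInf_add]
  refine le_iInf₂ fun n hn => le_iInf fun y => (iInf₂_le n hn).trans ((iInf_le _ y).trans ?_)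
  rw [add_assoc, ← mul_add, add_comm (edist x' y)]
  gcongr
  exact edist_triangle _ _ _

theorem monotone_tailLipschitzEnvelope (g : ℕ → X → ℝ≥0∞) :
    Monotone (tailLipschitzEnvelope g) := by
  intro N N' h x
  refine le_iInf₂ fun n hn => le_iInf fun y =>
    (iInf₂_le n (h.trans hn)).trans ((iInf_le _ y).trans ?_)
  gcongr

theorem le_iSup_tailLipschitzEnvelope {g : ℕ → X → ℝ≥0∞} {x : X} {a : ℝ≥0∞}
    (h : ∀ c : ℝ≥0, c < a → ∀ᶠ p in 𝓝 x ×ˢ atTop, c ≤ g p.2 p.1) :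
    a ≤ ⨆ N, tailLipschitzEnvelope g N x := by
  refine ENNReal.le_of_forall_nnreal_lt fun c hc => ?_
  obtain ⟨p, hp, q, hq, hpq⟩ := eventually_prod_iff.1 (h c hc)
  obtain ⟨ε, hε, hball⟩ := EMetric.mem_nhds_iff.1 hp
  obtain ⟨N₀, hN₀⟩ := eventually_atTop.1 hq
  obtain ⟨N₁, hN₁⟩ := ENNReal.exists_nat_mul_gt hε.ne' (b := c) (by simp)
  obtain ⟨N₂, hN₂⟩ := exists_nat_ge c
  -- `N₀` controls the tail, `N₁` makes the Lipschitz penalty outside the ball of radius `ε` exceed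
  -- `c`, and `N₂` raises the truncation level to at least `c`
  refine le_iSup_of_le (max N₀ (max N₁ N₂)) ?_
  set N := max N₀ (max N₁ N₂)
  refine le_iInf₂ fun n hn => le_iInf fun y => ?_
  by_cases hy : edist x y < ε
  · refine le_add_right (le_min ?_ ?_)
    · exact hpq (hball (by rwa [Metric.mem_eball, edist_comm]))
        (hN₀ n (le_trans (le_max_left _ _) hn))
    · have : N₂ ≤ N := by simp [N]
      calc (c : ℝ≥0∞) ≤ (N₂ : ℝ≥0) := by exact_mod_cast hN₂
        _ ≤ N := by exact_mod_cast this
  · refine le_add_left (hN₁.le.trans ?_)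
    have : N₁ ≤ N := by simp [N]
    gcongr
    exact not_lt.1 hy

variable [MeasurableSpace X] [OpensMeasurableSpace X]

/-- Fatou's lemma for measures `Q n` satisfying the open-set condition of the portmanteau theorem
with limit `P`, and for functions `g n` whose lower limit is taken jointly in the point and the
index. No measurability is needed, since everything passes through the Lipschitz envelopes. -/
theorem lintegral_le_liminf_lintegral_of_joint_liminf {P : Measure X} {Q : ℕ → Measure X}
    (hQ : ∀ G, IsOpen G → P G ≤ liminf (fun n => Q n G) atTop)
    {g : ℕ → X → ℝ≥0∞} {gInf : X → ℝ≥0∞}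
    (hg : ∀ x, ∀ c : ℝ≥0, c < gInf x → ∀ᶠ p in 𝓝 x ×ˢ atTop, c ≤ g p.2 p.1) :
    ∫⁻ x, gInf x ∂P ≤ liminf (fun n => ∫⁻ x, g n x ∂(Q n)) atTop := by
  calc ∫⁻ x, gInf x ∂P ≤ ∫⁻ x, ⨆ N, tailLipschitzEnvelope g N x ∂P :=
        lintegral_mono fun x => le_iSup_tailLipschitzEnvelope (hg x)
    _ = ⨆ N, ∫⁻ x, tailLipschitzEnvelope g N x ∂P :=
        lintegral_iSup (fun N => (continuous_tailLipschitzEnvelope g N).measurable)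
          (monotone_tailLipschitzEnvelope g)
    _ ≤ _ := iSup_le fun N => ?_
  have hfin : ∀ x, tailLipschitzEnvelope g N x ≠ ∞ := fun x =>
    ne_top_of_le_ne_top (by simp) ((tailLipschitzEnvelope_le le_rfl x).trans (min_le_right _ _))
  have hport := lintegral_le_liminf_lintegral_of_forall_isOpen_measure_le_liminf_measure
    (μ := P) (μs := Q) (f := fun x => (tailLipschitzEnvelope g N x).toReal)
    (ENNReal.continuousOn_toReal.comp_continuous (continuous_tailLipschitzEnvelope g N) hfin)
    (fun x => ENNReal.toReal_nonneg) hQ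
  simp only [ENNReal.ofReal_toReal (hfin _)] at hport
  refine hport.trans (liminf_le_liminf ?_)
  filter_upwards [eventually_ge_atTop N] with n hn
  exact lintegral_mono fun x => (tailLipschitzEnvelope_le hn x).trans (min_le_left _ _)

end Fatou

/-! ### Energies with centres at infinity -/

section Cost

/-- The cost `d x a` of a centre `a` that may lie at infinity (`a = none`), where it is `∞`. -/
noncomputable def extCost {X : Type*} (d : X → X → ℝ≥0) (x : X) (a : Option X) : ℝ≥0∞ :=
  a.elim ∞ fun y => d x y

/-- The smallest of the costs of finitely many centres, some of which may lie at infinity. -/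
noncomputable def extMinCost {X : Type*} {k : ℕ} (d : X → X → ℝ≥0) (ν : Fin k → Option X)
    (x : X) : ℝ≥0∞ :=
  ⨅ j, extCost d x (ν j)

/-- The energy `∫ min_j d(x, ν_j) Q(dx)` of centres that may lie at infinity. Ordinary centres
`μ : Fin k → X` enter as `fun j => some (μ j)`. -/
noncomputable def extEnergy {X : Type*} [MeasurableSpace X] {k : ℕ} (d : X → X → ℝ≥0)
    (Q : Measure X) (ν : Fin k → Option X) : ℝ≥0∞ :=
  ∫⁻ x, extMinCost d ν x ∂Q

/-- Convergence of a sequence to a point weakly, or to infinity in norm. -/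
def ExtTendsto {X : Type*} [NormedAddCommGroup X] [NormedSpace ℝ X] (u : ℕ → X) :
    Option X → Prop
  | none => Tendsto (fun n => ‖u n‖) atTop atTop
  | some y => WeakTendsto u y

theorem extMinCost_some {X : Type*} {k : ℕ} (hk : 1 ≤ k) (d : X → X → ℝ≥0) (μ : Fin k → X)
    (x : X) : extMinCost d (fun j => some (μ j)) x = minCost d μ x := by
  have : Nonempty (Fin k) := ⟨⟨0, hk⟩⟩
  simp [extMinCost, minCost, extCost, ENNReal.coe_iInf]

theorem extCost_some_getD_le {X : Type*} (d : X → X → ℝ≥0) (x z : X) (a : Option X) :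
    extCost d x (some (a.getD z)) ≤ extCost d x a := by
  cases a <;> simp [extCost]

variable {X : Type*} [NormedAddCommGroup X] [NormedSpace ℝ X]

theorem ExtTendsto.comp {u : ℕ → X} {a : Option X} (h : ExtTendsto u a) {φ : ℕ → ℕ}
    (hφ : StrictMono φ) : ExtTendsto (fun n => u (φ n)) a := by
  cases a with
  | none => exact Tendsto.comp (g := fun n => ‖u n‖) h hφ.tendsto_atTop
  | some y => exact fun F => (h F).comp hφ.tendsto_atTop

section Subsequences

variable [TopologicalSpace.SeparableSpace X]

theorem IsReflexiveSpace.exists_extTendsto_subseq (hX : IsReflexiveSpace X) (u : ℕ → X) :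
    ∃ (φ : ℕ → ℕ) (a : Option X), StrictMono φ ∧ ExtTendsto (fun n => u (φ n)) a := by
  by_cases h : Tendsto (fun n => ‖u n‖) atTop atTop
  · exact ⟨id, none, strictMono_id, h⟩
  · simp only [tendsto_atTop, not_forall, not_eventually, not_le] at h
    obtain ⟨R, hR⟩ := h
    obtain ⟨φ, hφ, hb⟩ := extraction_of_frequently_atTop hR
    obtain ⟨ψ, x, hψ, hx⟩ := hX.exists_weakTendsto_subseq (u := fun n => u (φ n))
      (isBounded_iff_forall_norm_le.2 ⟨R, by rintro _ ⟨n, rfl⟩; exact (hb n).le⟩)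
    exact ⟨φ ∘ ψ, some x, hφ.comp hψ, hx⟩

theorem IsReflexiveSpace.exists_extTendsto_subseq_pi (hX : IsReflexiveSpace X) {k : ℕ}
    (u : ℕ → Fin k → X) :
    ∃ (φ : ℕ → ℕ) (ν : Fin k → Option X), StrictMono φ ∧
      ∀ j, ExtTendsto (fun n => u (φ n) j) (ν j) := by
  have key : ∀ s : Finset (Fin k), ∃ φ : ℕ → ℕ, StrictMono φ ∧
      ∀ j ∈ s, ∃ a, ExtTendsto (fun n => u (φ n) j) a := by
    intro s
    induction s using Finset.induction_on with
    | empty => exact ⟨id, strictMono_id, by simp⟩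
    | insert i s _ ih =>
      obtain ⟨φ, hφ, h⟩ := ih
      obtain ⟨ψ, a, hψ, ha⟩ := hX.exists_extTendsto_subseq fun n => u (φ n) i
      refine ⟨φ ∘ ψ, hφ.comp hψ, fun j hj => ?_⟩
      rcases Finset.mem_insert.1 hj with rfl | hj
      · exact ⟨a, ha⟩
      · obtain ⟨b, hb⟩ := h j hj
        exact ⟨b, hb.comp hψ⟩
  obtain ⟨φ, hφ, h⟩ := key Finset.univ
  choose ν hν using fun j => h j (Finset.mem_univ j)
  exact ⟨φ, ν, hφ, hν⟩

end Subsequences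

variable [MeasurableSpace X] {k : ℕ} {d : X → X → ℝ≥0} {P : Measure X}

theorem CostAssumptions.eventually_le_cost (hdP : CostAssumptions k d P) {v : ℕ → X}
    {a : Option X} (h : ExtTendsto v a) (x : X) {c : ℝ≥0} (hc : c < extCost d x a) :
    ∀ᶠ p : X × ℕ in 𝓝 x ×ˢ atTop, (c : ℝ≥0∞) ≤ extCost d p.1 (some (v p.2)) := by
  cases a with
  | none =>
    obtain ⟨m, M, -, -, -, -, hmM, hm, -⟩ := hdP.bounds
    obtain ⟨R, hR⟩ := eventually_atTop.1 (hm.eventually_ge_atTop c)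
    have h1 : ∀ᶠ y in 𝓝 x, ‖y‖ < ‖x‖ + 1 :=
      continuous_norm.continuousAt.eventually_lt continuousAt_const (by simp)
    have h2 : ∀ᶠ n in atTop, R + (‖x‖ + 1) ≤ ‖v n‖ := h.eventually_ge_atTop _
    filter_upwards [h1.prod_mk h2] with p hp
    have h3 : R ≤ ‖p.1 - v p.2‖₊ := by
      rw [← NNReal.coe_le_coe, coe_nnnorm]
      have := norm_sub_norm_le (v p.2) p.1
      rw [norm_sub_rev] at this
      linarith [hp.1, hp.2]
    exact ENNReal.coe_le_coe.2 ((hR _ h3).trans (hmM _ _).1)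
  | some y =>
    rw [eventually_iff_seq_eventually]
    intro p hp
    have h1 : Tendsto (fun n => (p n).1) atTop (𝓝 x) := tendsto_fst.comp hp
    have h2 : Tendsto (fun n => (p n).2) atTop atTop := tendsto_snd.comp hp
    have h3 := eventually_lt_of_lt_liminf (lt_of_lt_of_le hc (hdP.lsc x y _ v h1 h))
    exact ((tendsto_id.prodMk h2).eventually h3).mono fun n hn => hn.le

/-- The lower bound in the `Γ`-convergence of the energies, also for centres that escape to
infinity. -/
theorem CostAssumptions.extEnergy_le_liminf [OpensMeasurableSpace X]
    (hdP : CostAssumptions k d P) {Q₀ : Measure X} {Q : ℕ → Measure X}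
    (hQ : ∀ G, IsOpen G → Q₀ G ≤ liminf (fun n => Q n G) atTop) {μ : ℕ → Fin k → X}
    {ν : Fin k → Option X} (h : ∀ j, ExtTendsto (fun n => μ n j) (ν j)) :
    extEnergy d Q₀ ν ≤ liminf (fun n => extEnergy d (Q n) fun j => some (μ n j)) atTop := by
  refine lintegral_le_liminf_lintegral_of_joint_liminf hQ
    (g := fun n => extMinCost d fun j => some (μ n j)) fun x c hc => ?_
  have := eventually_all.2 fun j =>
    hdP.eventually_le_cost (h j) x (hc.trans_le (iInf_le _ j))
  exact this.mono fun p hp => le_iInf hp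

theorem CostAssumptions.exists_extEnergy_min [OpensMeasurableSpace X]
    [TopologicalSpace.SeparableSpace X] (hX : IsReflexiveSpace X)
    (hdP : CostAssumptions k d P) (Q : Measure X) :
    ∃ μ : Fin k → X, ∀ μ' : Fin k → X,
      extEnergy d Q (fun j => some (μ j)) ≤ extEnergy d Q fun j => some (μ' j) := by
  set e : (Fin k → X) → ℝ≥0∞ := fun μ => extEnergy d Q fun j => some (μ j)
  obtain ⟨w, -, hw, hwmem⟩ := exists_seq_tendsto_sInf (Set.range_nonempty e) (OrderBot.bddBelow _)
  choose u hu using hwmem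
  obtain ⟨φ, ν, hφ, hν⟩ := hX.exists_extTendsto_subseq_pi u
  have hle := hdP.extEnergy_le_liminf (Q₀ := Q) (Q := fun _ => Q) (fun G _ => by simp) hν
  have hlim : Tendsto (fun n => e (u (φ n))) atTop (𝓝 (sInf (Set.range e))) := by
    simpa only [hu, Function.comp_def] using hw.comp hφ.tendsto_atTop
  rw [hlim.liminf_eq] at hle
  -- bringing the centres at infinity to the origin does not increase the energy
  refine ⟨fun j => (ν j).getD 0, fun μ' => ?_⟩
  calc _ ≤ extEnergy d Q ν :=
        lintegral_mono fun x => iInf_mono fun j => extCost_some_getD_le d x 0 (ν j)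
    _ ≤ _ := hle.trans (sInf_le ⟨μ', rfl⟩)

theorem CostAssumptions.measurable_extMinCost (hdP : CostAssumptions k d P)
    (ν : Fin k → Option X) : Measurable (extMinCost d ν) := by
  refine Measurable.iInf fun j => ?_
  cases h : ν j with
  | none => exact measurable_const
  | some y => exact (hdP.meas y).coe_nnreal_ennreal

theorem CostAssumptions.measurable_minCost (hdP : CostAssumptions k d P) (μ : Fin k → X) :
    Measurable (minCost d μ) :=
  Measurable.iInf fun j => hdP.meas (μ j)

theorem CostAssumptions.extEnergy_some_lt_top [IsProbabilityMeasure P] (hk : 1 ≤ k)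
    (hdP : CostAssumptions k d P) (μ : Fin k → X) :
    extEnergy d P (fun j => some (μ j)) < ∞ := by
  obtain ⟨m, M, -, -, -, -, hmM, -, -, ⟨γ, hγ⟩, hint⟩ := hdP.bounds
  set y := μ ⟨0, hk⟩
  calc extEnergy d P (fun j => some (μ j))
      ≤ ∫⁻ x, (γ * M ‖x‖₊ + γ * M ‖y‖₊ : ℝ≥0∞) ∂P := by
        refine lintegral_mono fun x => (iInf_le _ ⟨0, hk⟩).trans ?_
        have h1 := (hmM x y).2
        have h2 := hγ x (-y)
        rw [← sub_eq_add_neg, nnnorm_neg] at h2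
        exact (ENNReal.coe_le_coe.2 (h1.trans h2)).trans_eq (by push_cast; rfl)
    _ < ∞ := by
        rw [lintegral_add_right _ measurable_const, lintegral_const_mul' _ _ (by simp)]
        simpa using! ⟨ENNReal.mul_lt_top (by simp) hint, ENNReal.mul_lt_top (by simp) (by simp)⟩

theorem CostAssumptions.cost_self (hdP : CostAssumptions k d P) (x : X) : d x x = 0 := by
  obtain ⟨m, M, -, -, -, -, hmM, -, hM0, -⟩ := hdP.bounds
  simpa [hM0] using (hmM x x).2

theorem CostAssumptions.cost_pos (hdP : CostAssumptions k d P) {x y : X} (h : x ≠ y) :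
    0 < d x y := by
  obtain ⟨m, M, -, hm, -, -, hmM, -⟩ := hdP.bounds
  refine lt_of_lt_of_le ?_ (hmM x y).1
  exact zero_le.trans_lt (hm (nnnorm_pos.2 (sub_ne_zero.2 h)))

theorem CostAssumptions.tendsto_cost (hdP : CostAssumptions k d P) (x y : X) :
    Tendsto (fun z => d z y) (𝓝 x) (𝓝 (d x y)) :=
  tendsto_iff_seq_tendsto.2 fun u hu => hdP.cont x y u hu

/-- Centres with one of them at infinity do not have minimal energy: one of the `k` charged points
is not among them, and moving the centre at infinity there lowers the cost in a neighbourhood. -/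
theorem CostAssumptions.exists_extEnergy_lt [BorelSpace X] [IsProbabilityMeasure P] (hk : 1 ≤ k)
    (hdP : CostAssumptions k d P) {ν : Fin k → Option X} {j₀ : Fin k} (hj₀ : ν j₀ = none) :
    ∃ μ : Fin k → X, extEnergy d P (fun j => some (μ j)) < extEnergy d P ν := by
  have : Nonempty (Fin k) := ⟨j₀⟩
  obtain ⟨c, hc, hpos⟩ := hdP.fit
  obtain ⟨i, hi⟩ : ∃ i, ∀ j, ν j ≠ some (c i) := by
    by_contra! h
    choose f hf using h
    have hinj : Function.Injective f := fun a b hab =>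
      hc (Option.some_injective _ (by rw [← hf a, ← hf b, hab]))
    obtain ⟨a, ha⟩ := Finite.surjective_of_injective hinj j₀
    have := hf a
    simp [ha, hj₀] at this
  set μ : Fin k → X := fun j => ((Function.update ν j₀ (some (c i)) j).getD 0)
  have hcost : ∀ x, extMinCost d (fun j => some (μ j)) x ≤ d x (c i) := fun x =>
    (iInf_le _ j₀).trans (by simp [μ, extCost])
  have hle : ∀ x, extMinCost d (fun j => some (μ j)) x ≤ extMinCost d ν x := by
    refine fun x => iInf_mono fun j => (extCost_some_getD_le d x 0 _).trans ?_
    by_cases h : j = j₀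
    · subst h; simp [hj₀, extCost]
    · simp [h]
  have hlt : ∀ᶠ x in 𝓝 (c i), extMinCost d (fun j => some (μ j)) x < extMinCost d ν x := by
    have h : ∀ j, ∀ᶠ x in 𝓝 (c i), (d x (c i) : ℝ≥0∞) < extCost d x (ν j) := by
      intro j
      cases hj : ν j with
      | none => exact Eventually.of_forall fun x => ENNReal.coe_lt_top
      | some y =>
        have hne : c i ≠ y := fun h => hi j (by rw [hj, h])
        filter_upwards [(hdP.tendsto_cost (c i) (c i)).eventually_lt (hdP.tendsto_cost (c i) y)
          (by rw [hdP.cost_self]; exact hdP.cost_pos hne)] with x hx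
        exact ENNReal.coe_lt_coe.2 hx
    filter_upwards [eventually_all.2 h] with x hx
    obtain ⟨j, hj⟩ := exists_eq_ciInf_of_finite (f := fun j => extCost d x (ν j))
    exact (hcost x).trans_lt ((hx j).trans_eq hj)
  obtain ⟨δ, hδ, hball⟩ := Metric.eventually_nhds_iff_ball.1 hlt
  exact ⟨μ, lintegral_strict_mono_of_ae_le_of_ae_lt_on
    (hdP.measurable_extMinCost ν).aemeasurable (hdP.extEnergy_some_lt_top hk μ).ne
    (Eventually.of_forall hle) (hpos δ hδ i).ne' (Eventually.of_forall hball)⟩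

end Cost

/-! ### Minimizers along a fixed data sequence -/

section Minimizers

variable {X : Type*} [NormedAddCommGroup X] [NormedSpace ℝ X]
  [TopologicalSpace.SeparableSpace X] [MeasurableSpace X] [BorelSpace X] {k : ℕ}
  {d : X → X → ℝ≥0} {P : Measure X} [IsProbabilityMeasure P]

theorem le_liminf_comp_of_le_liminf {u : ℕ → ℝ≥0∞} {a : ℝ≥0∞} (h : a ≤ liminf u atTop)
    {φ : ℕ → ℕ} (hφ : Tendsto φ atTop atTop) : a ≤ liminf (fun n => u (φ n)) atTop :=
  by
  refine h.trans (?_ : liminf u atTop ≤ liminf u (map φ atTop))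
  exact liminf_le_liminf_of_le hφ

/-- No centre is lost at infinity along a subsequence of minimizers, since the limit would have
minimal energy with a centre at infinity. -/
theorem CostAssumptions.exists_subseq_weakTendsto_minimizer (hX : IsReflexiveSpace X)
    (hk : 1 ≤ k) (hdP : CostAssumptions k d P) {Q : ℕ → Measure X}
    (hQ : ∀ G, IsOpen G → P G ≤ liminf (fun n => Q n G) atTop) {μInf : Fin k → X}
    (hmin : ∀ μ' : Fin k → X,
      extEnergy d P (fun j => some (μInf j)) ≤ extEnergy d P fun j => some (μ' j))
    (hlim : Tendsto (fun n => extEnergy d (Q n) fun j => some (μInf j)) atTop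
      (𝓝 (extEnergy d P fun j => some (μInf j))))
    {μ : ℕ → Fin k → X}
    (hμ : ∀ n, 1 ≤ n → extEnergy d (Q n) (fun j => some (μ n j)) ≤
      extEnergy d (Q n) fun j => some (μInf j))
    {φ : ℕ → ℕ} (hφ : Tendsto φ atTop atTop) :
    ∃ (ψ : ℕ → ℕ) (ν : Fin k → X), StrictMono ψ ∧ WeakTendsto (fun n => μ (φ (ψ n))) ν ∧
      (∀ μ' : Fin k → X, extEnergy d P (fun j => some (ν j)) ≤
        extEnergy d P fun j => some (μ' j)) ∧
      Tendsto (fun n => extEnergy d (Q (φ (ψ n))) fun j => some (μ (φ (ψ n)) j)) atTop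
        (𝓝 (extEnergy d P fun j => some (μInf j))) := by
  obtain ⟨ψ, ν, hψ, hν⟩ := hX.exists_extTendsto_subseq_pi fun n => μ (φ n)
  have hφψ : Tendsto (fun n => φ (ψ n)) atTop atTop := hφ.comp hψ.tendsto_atTop
  have hinf := hdP.extEnergy_le_liminf
    (fun G hG => le_liminf_comp_of_le_liminf (hQ G hG) hφψ) hν
  have hsup : limsup (fun n => extEnergy d (Q (φ (ψ n))) fun j => some (μ (φ (ψ n)) j)) atTop ≤
      extEnergy d P fun j => some (μInf j) := by
    have h : Tendsto (fun n => extEnergy d (Q (φ (ψ n))) fun j => some (μInf j)) atTop _ :=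
      hlim.comp hφψ
    rw [← h.limsup_eq]
    exact limsup_le_limsup ((hφψ.eventually_ge_atTop 1).mono fun n hn => hμ _ hn)
  have hνle := hinf.trans ((liminf_le_limsup (f := atTop)).trans hsup)
  have hsome : ∀ j, ∃ y, ν j = some y := by
    intro j
    cases hj : ν j with
    | none =>
      obtain ⟨μ', hμ'⟩ := hdP.exists_extEnergy_lt hk hj
      exact absurd (hmin μ') (hμ'.trans_le hνle).not_ge
    | some y => exact ⟨y, rfl⟩
  choose ν' hν' using hsome
  obtain rfl : ν = fun j => some (ν' j) := funext hν'
  exact ⟨ψ, ν', hψ, weakTendsto_pi.2 hν, fun μ' => hνle.trans (hmin μ'),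
    tendsto_of_le_liminf_of_limsup_le ((hmin ν').trans hinf) hsup⟩

/-- Weak subsequential compactness keeps the norms of the minimizers bounded. -/
theorem isBounded_range_of_exists_subseq_weakTendsto {E : Type*} [NormedAddCommGroup E]
    [NormedSpace ℝ E] {u : ℕ → E}
    (h : ∀ φ : ℕ → ℕ, StrictMono φ → ∃ (ψ : ℕ → ℕ) (x : E), StrictMono ψ ∧
      WeakTendsto (fun n => u (φ (ψ n))) x) : Bornology.IsBounded (Set.range u) := by
  obtain ⟨R, hR⟩ : ∃ R : ℕ, ∀ᶠ n in atTop, ‖u n‖ ≤ R := by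
    by_contra! hcon
    obtain ⟨φ, hφ, hR⟩ := extraction_forall_of_frequently
      (P := fun R n => (R : ℝ) < ‖u n‖) fun R => by simpa using hcon R
    obtain ⟨ψ, x, hψ, hx⟩ := h φ hφ
    refine hx.not_tendsto_norm_atTop ?_
    exact (tendsto_atTop_mono (fun n => (hR n).le) tendsto_natCast_atTop_atTop).comp
      hψ.tendsto_atTop
  have h1 : IsBoundedUnder (· ≤ ·) atTop fun n => ‖u n‖ := ⟨R, by simpa using hR⟩
  obtain ⟨C, hC⟩ := h1.bddAbove_range
  exact isBounded_iff_forall_norm_le.2 ⟨C, by rintro _ ⟨n, rfl⟩; exact hC ⟨n, rfl⟩⟩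

end Minimizers

/-! ### Empirical measures -/

section Empirical

variable {X : Type*} [MeasurableSpace X]

/-- The empirical measure of the first `n` terms of a sequence (the zero measure for `n = 0`). -/
noncomputable def empiricalMeasure (x : ℕ → X) (n : ℕ) : Measure X :=
  ENNReal.ofReal (1 / (n : ℝ)) • ∑ i ∈ Finset.range n, Measure.dirac (x i)

theorem lintegral_empiricalMeasure (x : ℕ → X) (n : ℕ) {f : X → ℝ≥0} (hf : Measurable f) :
    ∫⁻ y, f y ∂(empiricalMeasure x n) =
      ENNReal.ofReal (1 / (n : ℝ) * ∑ i ∈ Finset.range n, (f (x i) : ℝ)) := by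
  rw [empiricalMeasure, lintegral_smul_measure, lintegral_finsetSum_measure,
    ENNReal.ofReal_mul (by positivity),
    ENNReal.ofReal_sum_of_nonneg (fun _ _ => NNReal.coe_nonneg _)]
  simp [lintegral_dirac' _ hf.coe_nnreal_ennreal]

variable {Ω : Type*} [MeasurableSpace Ω] {Pr : Measure Ω} {P : Measure X} {ξ : ℕ → Ω → X}

theorem ae_tendsto_lintegral_empiricalMeasure (hmeas : ∀ i, Measurable (ξ i))
    (hlaw : ∀ i, Pr.map (ξ i) = P) (hindep : iIndepFun ξ Pr) {f : X → ℝ≥0} (hf : Measurable f)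
    (hfin : ∫⁻ y, f y ∂P < ∞) :
    ∀ᵐ ω ∂Pr, Tendsto (fun n => ∫⁻ y, f y ∂(empiricalMeasure (fun i => ξ i ω) n)) atTop
      (𝓝 (∫⁻ y, f y ∂P)) := by
  have hf' : Measurable fun y => (f y : ℝ) := hf.coe_nnreal_real
  have hint : Integrable (fun y => (f y : ℝ)) P :=
    ⟨hf'.aestronglyMeasurable, by simpa [HasFiniteIntegral] using hfin⟩
  have hlln := strong_law_ae_real (μ := Pr) (fun i ω => (f (ξ i ω) : ℝ))
    (by
      rw [← hlaw 0] at hint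
      exact hint.comp_measurable (hmeas 0))
    (fun i j hij => (hindep.indepFun hij).comp hf' hf')
    (fun i => (IdentDistrib.mk (hmeas i).aemeasurable (hmeas 0).aemeasurable
      ((hlaw i).trans (hlaw 0).symm)).comp hf')
  have hexp : ∫ ω, (f (ξ 0 ω) : ℝ) ∂Pr = ∫ y, (f y : ℝ) ∂P := by
    rw [← hlaw 0, integral_map (hmeas 0).aemeasurable hf'.aestronglyMeasurable]
  have hP : ∫⁻ y, f y ∂P = ENNReal.ofReal (∫ y, (f y : ℝ) ∂P) := by
    rw [ofReal_integral_eq_lintegral_ofReal hint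
      (Eventually.of_forall fun _ => NNReal.coe_nonneg _)]
    simp
  filter_upwards [hlln] with ω hω
  simp_rw [lintegral_empiricalMeasure _ _ hf, hP]
  refine ENNReal.tendsto_ofReal ?_
  rw [hexp] at hω
  simpa only [one_div, inv_mul_eq_div] using hω

/-- Finite unions of sets of a countable basis form a countable family that exhausts every open
set from inside, so almost surely the law of large numbers holds for all of them at once. -/
theorem ae_forall_isOpen_le_liminf_empiricalMeasure [TopologicalSpace X]
    [SecondCountableTopology X] [OpensMeasurableSpace X] [IsFiniteMeasure P]
    (hmeas : ∀ i, Measurable (ξ i)) (hlaw : ∀ i, Pr.map (ξ i) = P) (hindep : iIndepFun ξ Pr) :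
    ∀ᵐ ω ∂Pr, ∀ G, IsOpen G →
      P G ≤ liminf (fun n => empiricalMeasure (fun i => ξ i ω) n G) atTop := by
  set B := TopologicalSpace.countableBasis X
  have : Countable B := (TopologicalSpace.countable_countableBasis X).to_subtype
  let U : Finset B → Set X := fun T => ⋃ b ∈ T, (b : Set X)
  have hU : ∀ T, MeasurableSet (U T) := fun T => Finset.measurableSet_biUnion T fun b _ =>
    (TopologicalSpace.isOpen_of_mem_countableBasis b.2).measurableSet
  have hlln : ∀ᵐ ω ∂Pr, ∀ T, Tendsto (fun n => empiricalMeasure (fun i => ξ i ω) n (U T)) atTop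
      (𝓝 (P (U T))) := by
    refine ae_all_iff.2 fun T => ?_
    have hind : ∀ Q : Measure X,
        ∫⁻ y, (((U T).indicator (1 : X → ℝ≥0) y : ℝ≥0) : ℝ≥0∞) ∂Q = Q (U T) := by
      intro Q
      rw [← lintegral_indicator_one (hU T)]
      refine lintegral_congr fun y => ?_
      by_cases hy : y ∈ U T <;> simp [hy]
    have := ae_tendsto_lintegral_empiricalMeasure hmeas hlaw hindep
      (f := (U T).indicator (1 : X → ℝ≥0)) (measurable_one.indicator (hU T))
      (by rw [hind]; exact measure_lt_top _ _)
    simpa only [hind] using this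
  filter_upwards [hlln] with ω hω G hG
  let S := {T : Finset B // U T ⊆ G}
  have hGU : G = ⋃ T : S, U T := by
    refine Set.Subset.antisymm (fun x hx => ?_) (Set.iUnion_subset fun T => T.2)
    obtain ⟨b, hb, hxb, hbG⟩ :=
      (TopologicalSpace.isBasis_countableBasis X).exists_subset_of_mem_open hx hG
    have hUb : U {⟨b, hb⟩} = b :=
      Finset.set_biUnion_singleton (⟨b, hb⟩ : B) fun b : B => (b : Set X)
    have hbU : U {⟨b, hb⟩} ⊆ G := by rw [hUb]; exact hbG
    have hxU : x ∈ U {⟨b, hb⟩} := by rw [hUb]; exact hxb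
    exact Set.mem_iUnion.2 ⟨⟨_, hbU⟩, hxU⟩
  have hdir : Directed (· ⊆ ·) fun T : S => U T := by
    classical
    intro T T'
    have hmono : Monotone U := fun A A' h => Set.biUnion_subset_biUnion_left h
    refine ⟨⟨T.1 ∪ T'.1, ?_⟩, hmono Finset.subset_union_left, hmono Finset.subset_union_right⟩
    simp only [U, Finset.set_biUnion_union]
    exact Set.union_subset T.2 T'.2
  conv_lhs => rw [hGU]
  rw [hdir.measure_iUnion]
  refine iSup_le fun T => ?_
  rw [← (hω T).liminf_eq]
  exact liminf_le_liminf (Eventually.of_forall fun n => measure_mono T.2)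

end Empirical

/-! ### Convergence of the minimization problems -/

section Energies

variable {X : Type*} [NormedAddCommGroup X] [NormedSpace ℝ X] [MeasurableSpace X] {k : ℕ}
  {d : X → X → ℝ≥0} {P : Measure X}

theorem CostAssumptions.empiricalEnergy_eq_toReal (hk : 1 ≤ k) (hdP : CostAssumptions k d P)
    (x : ℕ → X) (n : ℕ) (μ : Fin k → X) :
    empiricalEnergy d x n μ =
      (extEnergy d (empiricalMeasure x n) fun j => some (μ j)).toReal := by
  simp only [extEnergy, extMinCost_some hk]
  rw [lintegral_empiricalMeasure x n (hdP.measurable_minCost μ), ENNReal.toReal_ofReal]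
  · rfl
  · positivity

theorem CostAssumptions.extEnergy_empiricalMeasure_ne_top (hk : 1 ≤ k)
    (hdP : CostAssumptions k d P) (x : ℕ → X) (n : ℕ) (μ : Fin k → X) :
    extEnergy d (empiricalMeasure x n) (fun j => some (μ j)) ≠ ∞ := by
  simp only [extEnergy, extMinCost_some hk]
  rw [lintegral_empiricalMeasure x n (hdP.measurable_minCost μ)]
  exact ENNReal.ofReal_ne_top

theorem CostAssumptions.limitEnergy_eq_toReal (hk : 1 ≤ k) (hdP : CostAssumptions k d P)
    (μ : Fin k → X) :
    limitEnergy d P μ = (extEnergy d P fun j => some (μ j)).toReal := by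
  rw [limitEnergy, integral_eq_lintegral_of_nonneg_ae
    (Eventually.of_forall fun _ => NNReal.coe_nonneg _)
    (hdP.measurable_minCost μ).coe_nnreal_real.aestronglyMeasurable]
  simp [extEnergy, extMinCost_some hk]

theorem CostAssumptions.integrable_minCost [IsProbabilityMeasure P] (hk : 1 ≤ k)
    (hdP : CostAssumptions k d P) (μ : Fin k → X) :
    Integrable (fun x => (minCost d μ x : ℝ)) P := by
  refine ⟨(hdP.measurable_minCost μ).coe_nnreal_real.aestronglyMeasurable, ?_⟩
  simpa [HasFiniteIntegral, extEnergy, extMinCost_some hk] using hdP.extEnergy_some_lt_top hk μ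

theorem CostAssumptions.isMinOn_limitEnergy_iff [IsProbabilityMeasure P] (hk : 1 ≤ k)
    (hdP : CostAssumptions k d P) {μ : Fin k → X} :
    IsMinOn (limitEnergy d P) Set.univ μ ↔ ∀ μ' : Fin k → X,
      extEnergy d P (fun j => some (μ j)) ≤ extEnergy d P fun j => some (μ' j) := by
  simp only [isMinOn_univ_iff, hdP.limitEnergy_eq_toReal hk]
  exact forall_congr' fun μ' => ENNReal.toReal_le_toReal (hdP.extEnergy_some_lt_top hk μ).ne
    (hdP.extEnergy_some_lt_top hk μ').ne

theorem CostAssumptions.isMinOn_empiricalEnergy_iff (hk : 1 ≤ k) (hdP : CostAssumptions k d P)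
    {x : ℕ → X} {n : ℕ} {μ : Fin k → X} :
    IsMinOn (empiricalEnergy d x n) Set.univ μ ↔ ∀ μ' : Fin k → X,
      extEnergy d (empiricalMeasure x n) (fun j => some (μ j)) ≤
        extEnergy d (empiricalMeasure x n) fun j => some (μ' j) := by
  simp only [isMinOn_univ_iff, hdP.empiricalEnergy_eq_toReal hk]
  exact forall_congr' fun μ' =>
    ENNReal.toReal_le_toReal (hdP.extEnergy_empiricalMeasure_ne_top hk x n μ)
      (hdP.extEnergy_empiricalMeasure_ne_top hk x n μ')

theorem IsMinOn.iInf_eq_of_univ {α : Type*} {f : α → ℝ} {a : α} (h : IsMinOn f Set.univ a) :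
    ⨅ b, f b = f a :=
  have : Nonempty α := ⟨a⟩
  le_antisymm (ciInf_le ⟨f a, by rintro _ ⟨b, rfl⟩; exact isMinOn_univ_iff.1 h b⟩ a)
    (le_ciInf (isMinOn_univ_iff.1 h))

end Energies

theorem mainTheorem2 {X : Type*} [NormedAddCommGroup X] [NormedSpace ℝ X] [CompleteSpace X]
    [TopologicalSpace.SeparableSpace X] [MeasurableSpace X] [BorelSpace X]
    (hX : IsReflexiveSpace X)
    {Ω : Type*} [MeasurableSpace Ω] (Pr : Measure Ω) [IsProbabilityMeasure Pr]
    (P : Measure X) [IsProbabilityMeasure P]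
    (ξ : ℕ → Ω → X) (hmeas : ∀ i, Measurable (ξ i)) (hlaw : ∀ i, Pr.map (ξ i) = P)
    (hindep : iIndepFun ξ Pr)
    (k : ℕ) (hk : 1 ≤ k) (d : X → X → ℝ≥0) (hdP : CostAssumptions k d P) :
    -- `f_∞` is finite, and its minimum is attained
    (∀ μ : Fin k → X, Integrable (fun x => (minCost d μ x : ℝ)) P) ∧
    (∃ μ : Fin k → X, IsMinOn (limitEnergy d P) Set.univ μ) ∧
    ∀ᵐ ω ∂Pr,
      -- the minima of the `f_n` are attained, and they converge to the minimum of `f_∞`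
      (∀ n : ℕ, 1 ≤ n →
        ∃ μ : Fin k → X, IsMinOn (empiricalEnergy d (fun i => ξ i ω) n) Set.univ μ) ∧
      Tendsto (fun n : ℕ => ⨅ μ : Fin k → X, empiricalEnergy d (fun i => ξ i ω) n μ) atTop
        (𝓝 (⨅ μ : Fin k → X, limitEnergy d P μ)) ∧
      -- sequences of minimizers are weakly precompact with minimizing weak limit points
      ∀ μ : ℕ → Fin k → X,
        (∀ n : ℕ, 1 ≤ n → IsMinOn (empiricalEnergy d (fun i => ξ i ω) n) Set.univ (μ n)) →
        IsWeaklyPrecompact (Set.range μ) ∧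
        (∀ φ : ℕ → ℕ, StrictMono φ → ∃ (ψ : ℕ → ℕ) (ν : Fin k → X), StrictMono ψ ∧
          WeakTendsto (fun n => μ (φ (ψ n))) ν) ∧
        ∀ ν : Fin k → X, IsWeakLimitPoint μ ν → IsMinOn (limitEnergy d P) Set.univ ν := by
  obtain ⟨μInf, hmin⟩ := hdP.exists_extEnergy_min hX P
  have hlimit := hdP.isMinOn_limitEnergy_iff hk |>.2 hmin
  refine ⟨hdP.integrable_minCost hk, ⟨μInf, hlimit⟩, ?_⟩
  have hlln := ae_tendsto_lintegral_empiricalMeasure hmeas hlaw hindep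
    (hdP.measurable_minCost μInf)
    (by simpa only [extEnergy, extMinCost_some hk] using hdP.extEnergy_some_lt_top hk μInf)
  filter_upwards [ae_forall_isOpen_le_liminf_empiricalMeasure hmeas hlaw hindep, hlln]
    with ω hopen hω
  set Q := empiricalMeasure fun i => ξ i ω
  have hlim : Tendsto (fun n => extEnergy d (Q n) fun j => some (μInf j)) atTop
      (𝓝 (extEnergy d P fun j => some (μInf j))) := by
    simpa only [extEnergy, extMinCost_some hk] using hω
  have hexists : ∀ n : ℕ, ∃ μ : Fin k → X,
      IsMinOn (empiricalEnergy d (fun i => ξ i ω) n) Set.univ μ := fun n =>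
    (hdP.exists_extEnergy_min hX (Q n)).imp fun μ h =>
      hdP.isMinOn_empiricalEnergy_iff hk |>.2 h
  have key : ∀ μ : ℕ → Fin k → X,
      (∀ n : ℕ, 1 ≤ n → IsMinOn (empiricalEnergy d (fun i => ξ i ω) n) Set.univ (μ n)) →
      ∀ {φ : ℕ → ℕ}, Tendsto φ atTop atTop → _ := fun μ hμ φ hφ =>
    hdP.exists_subseq_weakTendsto_minimizer hX hk hopen hmin hlim
      (fun n hn => hdP.isMinOn_empiricalEnergy_iff hk |>.1 (hμ n hn) μInf) hφ
  refine ⟨fun n _ => hexists n, ?_, fun μ hμ => ?_⟩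
  · choose μ hμ using hexists
    simp only [fun n => (hμ n).iInf_eq_of_univ, hlimit.iInf_eq_of_univ]
    simp only [hdP.empiricalEnergy_eq_toReal hk, hdP.limitEnergy_eq_toReal hk]
    refine (ENNReal.tendsto_toReal (hdP.extEnergy_some_lt_top hk μInf).ne).comp
      (tendsto_of_subseq_tendsto fun φ hφ => ?_)
    obtain ⟨ψ, -, -, -, -, h⟩ := key μ (fun n _ => hμ n) hφ
    exact ⟨ψ, h⟩
  · have hsub : ∀ φ : ℕ → ℕ, StrictMono φ → ∃ (ψ : ℕ → ℕ) (ν : Fin k → X), StrictMono ψ ∧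
        WeakTendsto (fun n => μ (φ (ψ n))) ν := by
      intro φ hφ
      obtain ⟨ψ, ν, hψ, hν, -⟩ := key μ hμ hφ.tendsto_atTop
      exact ⟨ψ, ν, hψ, hν⟩
    have hbdd := isBounded_range_of_exists_subseq_weakTendsto hsub
    refine ⟨(hX.pi k).isWeaklyPrecompact hbdd, hsub, fun ν hν => ?_⟩
    obtain ⟨φ, hφ, hφν⟩ := (hX.pi k).exists_weakTendsto_of_isWeakLimitPoint hbdd hν
    obtain ⟨ψ, ν', hψ, hν', hmin', -⟩ := key μ hμ hφ.tendsto_atTop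
    obtain rfl : ν' = ν := hν'.unique fun F => (hφν F).comp hψ.tendsto_atTop
    exact hdP.isMinOn_limitEnergy_iff hk |>.2 hmin'
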